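/- Let $E$ and $F$ be complex Banach spaces, with topological duals $E^*$ and $F^*$. Suppose that $E$ has the metric $\pi$-property, i.e. there is a net $(S_\alpha)$ of finite-rank bounded linear projections on $E$ with $S_\alpha x \to x$ in norm for every $x \in E$ and $\limsup_\alpha \|S_\alpha\| \le 1$. Let $B_{E^*}$ be the open unit ball of $E^*$, and let $\mathcal{A}_{w^*u}(B_{E^*}; F^*)$ be the space of all bounded holomorphic (complex Fréchet differentiable) functions $f : B_{E^*} \to F^*$ that are weak$^*$-uniformly continuous, i.e. for every $\varepsilon > 0$ there is a weak$^*$-neighbourhood $U$ of $0$ in $E^*$ such that $\|f(x^*) - f(y^*)\| < \varepsilon$ for all $x^*, y^* \in B_{E^*}$ with $x^* - y^* \in U$; it is endowed with the norm $\|f\| = \sup_{x^* \in B_{E^*}} \|f(x^*)\|$. Every such $f$ extends uniquely to a norm-continuous function on the closed unit ball $\overline{B}_{E^*}$, still denoted by $f$, and $f$ is said to attain its norm if $\|f(x_0^*)\| = \|f\|$ for some $x_0^* \in \overline{B}_{E^*}$. Then the set of norm-attaining elements is dense in $\mathcal{A}_{w^*u}(B_{E^*}; F^*)$ with respect to this norm.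 -/

import Mathlib

open Filter Topology Metric
open scoped ENNReal BoundedContinuousFunction

noncomputable section

/-- The `π_c`-property: there is a net of finite-rank bounded linear projections on `E` which
converges strongly to the identity and satisfies `limsup ‖S α‖ ≤ c`. The `limsup` is taken in
`ℝ≥0∞`, so that it is a genuine one also for a net that is not bounded.  -/
def HasPiProperty.{u} (E : Type u) [NormedAddCommGroup E] [NormedSpace ℂ E] (c : ℝ≥0∞) : Prop :=
  ∃ (ι : Type u) (_ : Preorder ι) (_ : IsDirected ι (· ≤ ·)) (_ : Nonempty ι)
    (S : ι → E →L[ℂ] E),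
    (∀ α, S α ∘L S α = S α) ∧
    (∀ α, FiniteDimensional ℂ (LinearMap.range (S α : E →ₗ[ℂ] E))) ∧
    (∀ x : E, Tendsto (fun α => S α x) atTop (𝓝 x)) ∧
    limsup (fun α => ‖S α‖ₑ) atTop ≤ c

/-- The metric `π`-property is the `π_1`-property. -/
def HasMetricPiProperty.{u} (E : Type u) [NormedAddCommGroup E] [NormedSpace ℂ E] : Prop :=
  HasPiProperty E 1

/-- `H^∞(B_X; G)`: the bounded holomorphic (that is, complex Fréchet differentiable) functions on
the open unit ball of `X`, as a subspace of the bounded continuous functions on that ball; it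
carries the norm `‖f‖ = sup {‖f x‖ : x ∈ B_X}`. -/
def HInfty (X G : Type*) [NormedAddCommGroup X] [NormedSpace ℂ X]
    [NormedAddCommGroup G] [NormedSpace ℂ G] : Submodule ℂ (ball (0 : X) 1 →ᵇ G) where
  carrier := {f | ∃ g : X → G, DifferentiableOn ℂ g (ball 0 1) ∧ ∀ x : ball (0 : X) 1, g x = f x}
  zero_mem' := ⟨fun _ => 0, differentiableOn_const _, fun _ => rfl⟩
  add_mem' := by
    rintro f₁ f₂ ⟨g₁, h₁, e₁⟩ ⟨g₂, h₂, e₂⟩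
    exact ⟨fun x => g₁ x + g₂ x, h₁.add h₂, fun x => by simp [e₁, e₂]⟩
  smul_mem' := by
    rintro c f ⟨g, h, e⟩
    exact ⟨fun x => c • g x, h.const_smul c, fun x => by simp [e]⟩

/-- Weak*-uniform continuity (into `G` with its norm) of a function on the open unit ball of the
dual of `E`: for each `ε > 0` there is a weak*-neighbourhood `U` of `0` such that
`‖f x - f y‖ < ε` whenever `x`, `y` lie in the ball and `x - y ∈ U`. -/
def WeakStarUniformlyContinuous {E G : Type*} [NormedAddCommGroup E] [NormedSpace ℂ E]
    [NormedAddCommGroup G] (f : ball (0 : StrongDual ℂ E) 1 → G) : Prop :=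
  ∀ ε : ℝ, 0 < ε → ∃ U ∈ 𝓝 (0 : WeakDual ℂ E), ∀ x y : ball (0 : StrongDual ℂ E) 1,
    StrongDual.toWeakDual (x.1 - y.1) ∈ U → ‖f x - f y‖ < ε

/-- `𝒜_{w*u}(B_{E*}; G)`: the subspace of `H^∞(B_{E*}; G)` of the weak*-uniformly continuous
functions, with the supremum norm. -/
def AWeakStar (E G : Type*) [NormedAddCommGroup E] [NormedSpace ℂ E]
    [NormedAddCommGroup G] [NormedSpace ℂ G] :
    Submodule ℂ (ball (0 : StrongDual ℂ E) 1 →ᵇ G) where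
  carrier := {f | f ∈ HInfty (StrongDual ℂ E) G ∧ WeakStarUniformlyContinuous f}
  zero_mem' := ⟨zero_mem _, fun ε hε => ⟨Set.univ, univ_mem, fun x y _ => by simpa using hε⟩⟩
  add_mem' := by
    rintro f₁ f₂ ⟨h₁, u₁⟩ ⟨h₂, u₂⟩
    refine ⟨add_mem h₁ h₂, fun ε hε => ?_⟩
    obtain ⟨U₁, hU₁, k₁⟩ := u₁ (ε / 2) (half_pos hε)
    obtain ⟨U₂, hU₂, k₂⟩ := u₂ (ε / 2) (half_pos hε)
    refine ⟨U₁ ∩ U₂, inter_mem hU₁ hU₂, fun x y hxy => ?_⟩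
    have e : (f₁ + f₂) x - (f₁ + f₂) y = (f₁ x - f₁ y) + (f₂ x - f₂ y) := by
      simp only [BoundedContinuousFunction.coe_add, Pi.add_apply]
      abel
    rw [e]
    linarith [norm_add_le (f₁ x - f₁ y) (f₂ x - f₂ y), k₁ x y hxy.1, k₂ x y hxy.2]
  smul_mem' := by
    rintro c f ⟨h, u⟩
    refine ⟨Submodule.smul_mem _ c h, fun ε hε => ?_⟩
    obtain ⟨U, hU, k⟩ := u (ε / (‖c‖ + 1)) (by positivity)
    refine ⟨U, hU, fun x y hxy => ?_⟩
    have hk := k x y hxy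
    rw [lt_div_iff₀ (by positivity)] at hk
    have e : (c • f) x - (c • f) y = c • (f x - f y) := by
      simp [smul_sub]
    rw [e, norm_smul]
    nlinarith [norm_nonneg (f x - f y)]

/-- `f` attains its norm: `‖f x₀‖ = ‖f‖` for some point `x₀` of the closed unit ball, where `f` is
extended to the closed ball by continuity (the continuous extension `g` is unique, and it exists
if `f` is uniformly continuous and `G` is complete). -/
def AttainsNorm {X G : Type*} [NormedAddCommGroup X] [NormedAddCommGroup G]
    (f : ball (0 : X) 1 →ᵇ G) : Prop :=
  ∃ g : X → G, ContinuousOn g (closedBall 0 1) ∧ (∀ x : ball (0 : X) 1, g x = f x) ∧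
    ∃ x₀ ∈ closedBall (0 : X) 1, ‖g x₀‖ = ‖f‖

end

/-! Density holds because every element of the space attains its norm. The uniformity hypothesis
makes `f` send weak*-convergent filters on the ball to Cauchy filters, so completeness of the target
yields a weak*-continuous extension to the closed ball. The norm of this extension has a maximum
there by Banach-Alaoglu, and the maximum equals the supremum over the open ball. -/

/-- The open unit ball of the dual of `E`, as a subset of the weak* dual, is weak*-dense in the
closed unit ball. -/
theorem closedBall_subset_closure_toWeakDual_image_ball {E : Type*} [NormedAddCommGroup E]
    [NormedSpace ℂ E] {x : StrongDual ℂ E} (hx : x ∈ closedBall (0 : StrongDual ℂ E) 1) :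
    StrongDual.toWeakDual x ∈ closure (StrongDual.toWeakDual '' ball (0 : StrongDual ℂ E) 1) := by
  rw [← closure_ball (0 : StrongDual ℂ E) one_ne_zero] at hx
  exact image_closure_subset_closure_image NormedSpace.Dual.toWeakDual_continuous ⟨x, hx, rfl⟩

/-- A weak*-uniformly continuous function on the open unit ball of a dual space, with values in a
complete space, has a weak*-limit at each point of the weak* dual. -/
theorem WeakStarUniformlyContinuous.exists_tendsto {E G : Type*} [NormedAddCommGroup E]
    [NormedSpace ℂ E] [NormedAddCommGroup G] [CompleteSpace G]
    {f : ball (0 : StrongDual ℂ E) 1 → G} (hf : WeakStarUniformlyContinuous f)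
    {g : WeakDual ℂ E → G}
    (hg : ∀ x : ball (0 : StrongDual ℂ E) 1, g (StrongDual.toWeakDual x.1) = f x)
    {x : WeakDual ℂ E} (hx : x ∈ closure (StrongDual.toWeakDual '' ball (0 : StrongDual ℂ E) 1)) :
    ∃ y, Tendsto g (𝓝[StrongDual.toWeakDual '' ball (0 : StrongDual ℂ E) 1] x) (𝓝 y) := by
  have : NeBot (𝓝[StrongDual.toWeakDual '' ball (0 : StrongDual ℂ E) 1] x) :=
    mem_closure_iff_nhdsWithin_neBot.1 hx
  refine cauchy_map_iff_exists_tendsto.1 (cauchy_map_iff.2 ⟨‹_›, ?_⟩)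
  refine Metric.uniformity_basis_dist.tendsto_right_iff.2 fun ε hε => ?_
  obtain ⟨U, hU, hUf⟩ := hf ε hε
  -- Two points both weak*-close to `x` differ by an element of `U`.
  have hsub : Tendsto (fun p : WeakDual ℂ E × WeakDual ℂ E => p.1 - p.2) (𝓝 x ×ˢ 𝓝 x) (𝓝 0) := by
    rw [← nhds_prod_eq]
    simpa using (continuous_sub (G := WeakDual ℂ E)).tendsto (x, x)
  have hA := eventually_mem_nhdsWithin (a := x)
    (s := StrongDual.toWeakDual '' ball (0 : StrongDual ℂ E) 1)
  filter_upwards [(hsub.mono_left (prod_mono nhdsWithin_le_nhds nhdsWithin_le_nhds)).eventually hU,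
    hA.prod_mk hA]
  rintro ⟨_, _⟩ h ⟨⟨a, ha, rfl⟩, ⟨b, hb, rfl⟩⟩
  have := hUf ⟨a, ha⟩ ⟨b, hb⟩ (by rw [map_sub]; exact h)
  simpa [dist_eq_norm, hg ⟨a, ha⟩, hg ⟨b, hb⟩] using this

/-- A weak*-uniformly continuous function on the open unit ball of a dual space, with values in a
complete space, attains its norm: it extends to a weak*-continuous function on the closed unit
ball, which is weak*-compact by the Banach-Alaoglu theorem. -/
theorem WeakStarUniformlyContinuous.attainsNorm {E G : Type*} [NormedAddCommGroup E]
    [NormedSpace ℂ E] [NormedAddCommGroup G] [CompleteSpace G]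
    {f : ball (0 : StrongDual ℂ E) 1 →ᵇ G} (hf : WeakStarUniformlyContinuous f) :
    AttainsNorm f := by
  classical
  set A : Set (WeakDual ℂ E) := StrongDual.toWeakDual '' ball (0 : StrongDual ℂ E) 1
  set K : Set (WeakDual ℂ E) := WeakDual.toStrongDual ⁻¹' closedBall (0 : StrongDual ℂ E) 1
  -- The value 0 off the ball is harmless: limits of `φ` are only taken within `A`.
  let φ : WeakDual ℂ E → G := fun x =>
    if h : WeakDual.toStrongDual x ∈ ball (0 : StrongDual ℂ E) 1 then f ⟨_, h⟩ else 0
  have hφ (x : ball (0 : StrongDual ℂ E) 1) : φ (StrongDual.toWeakDual x.1) = f x :=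
    dif_pos x.2
  have hKA : K ⊆ closure A := fun x hx => closedBall_subset_closure_toWeakDual_image_ball hx
  have hlim : ∀ x ∈ K, ∃ y, Tendsto φ (𝓝[A] x) (𝓝 y) := fun x hx =>
    hf.exists_tendsto hφ (hKA hx)
  have hcont : ContinuousOn (extendFrom A φ) K := continuousOn_extendFrom hKA hlim
  have hmem (x : ball (0 : StrongDual ℂ E) 1) : StrongDual.toWeakDual x.1 ∈ K :=
    show x.1 ∈ closedBall (0 : StrongDual ℂ E) 1 from ball_subset_closedBall x.2
  have hext (x : ball (0 : StrongDual ℂ E) 1) :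
      extendFrom A φ (StrongDual.toWeakDual x.1) = f x := by
    obtain ⟨y, hy⟩ := hlim _ (hmem x)
    have hcomap : Tendsto (fun z : ball (0 : StrongDual ℂ E) 1 => StrongDual.toWeakDual z.1)
        (𝓝 x) (𝓝[A] (StrongDual.toWeakDual x.1)) :=
      tendsto_nhdsWithin_iff.2
        ⟨(NormedSpace.Dual.toWeakDual_continuous.comp continuous_subtype_val).tendsto x,
          Eventually.of_forall fun z => ⟨z.1, z.2, rfl⟩⟩
    -- Norm convergence implies weak* convergence, so along norm neighbourhoods of `x` the
    -- weak*-limit must agree with the limit `f x` given by norm continuity.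
    refine tendsto_nhds_unique ((tendsto_extendFrom ⟨y, hy⟩).comp hcomap) ?_
    exact (f.continuous.tendsto x).congr fun z => (hφ z).symm
  have hbound : ∀ x ∈ K, ‖extendFrom A φ x‖ ≤ ‖f‖ := by
    intro x hx
    have : NeBot (𝓝[A] x) := mem_closure_iff_nhdsWithin_neBot.1 (hKA hx)
    refine le_of_tendsto (tendsto_extendFrom (hlim x hx)).norm ?_
    filter_upwards [self_mem_nhdsWithin]
    rintro _ ⟨z, hz, rfl⟩
    exact (hφ ⟨z, hz⟩).symm ▸ f.norm_coe_le_norm ⟨z, hz⟩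
  obtain ⟨x₀, hx₀, hmax⟩ := (WeakDual.isCompact_closedBall (𝕜 := ℂ) 0 1).exists_isMaxOn
    ⟨_, hmem ⟨0, mem_ball_self one_pos⟩⟩ hcont.norm
  -- Weak*-continuity on the closed ball is stronger than the norm continuity required here.
  refine ⟨fun x => extendFrom A φ (StrongDual.toWeakDual x),
    hcont.comp NormedSpace.Dual.toWeakDual_continuous.continuousOn fun x hx => hx, hext,
    WeakDual.toStrongDual x₀, hx₀, le_antisymm (hbound x₀ hx₀) ?_⟩
  exact (BoundedContinuousFunction.norm_le (norm_nonneg _)).2 fun x => hext x ▸ hmax (hmem x)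

theorem theorem3p3 (E : Type*) [NormedAddCommGroup E] [NormedSpace ℂ E] [CompleteSpace E]
    (hE : HasMetricPiProperty E)
    (F : Type*) [NormedAddCommGroup F] [NormedSpace ℂ F] [CompleteSpace F] :
    Dense {f : AWeakStar E (StrongDual ℂ F) |
      AttainsNorm (f : ball (0 : StrongDual ℂ E) 1 →ᵇ StrongDual ℂ F)} :=
  dense_univ.mono fun f _ => f.2.2.attainsNorm
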